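/- Let $\{Y_x\}_{x\in\mathcal X}$ be a real Gaussian process with prior mean $\mu_x=\mathbb E[Y_x]$ and covariance $\sigma_{xx'}=\operatorname{cov}[Y_x,Y_{x'}]$. For finite $\mathcal A,\mathcal A'\subseteq\mathcal X$ write $\Sigma_{\mathcal A\mathcal A'}=[\sigma_{xx'}]_{x\in\mathcal A,x'\in\mathcal A'}$. Let $\mathcal S,\mathcal D,\mathcal U\subseteq\mathcal X$ be finite with $\mathcal D\cap\mathcal U=\emptyset$, let $\mathcal D$ and $\mathcal U$ be partitioned into $\mathcal D_1,\dots,\mathcal D_M$ and $\mathcal U_1,\dots,\mathcal U_M$, put $\mathcal V_m=\mathcal D_m\cup\mathcal U_m$ and $\mathcal V=\mathcal D\cup\mathcal U$, let $B\in\{1,\dots,M-1\}$, $\mathcal D_m^B=\bigcup_{k=m+1}^{\min(m+B,M)}\mathcal D_k$, and let $y_{\mathcal D}$ be a vector of realized outputs. Define $$Q_{\mathcal A\mathcal A'}=\Sigma_{\mathcal A\mathcal S}\Sigma_{\mathcal S\mathcal S}^{-1}\Sigma_{\mathcal S\mathcal A'},\qquad R_{\mathcal A\mathcal A'}=\Sigma_{\mathcal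 A\mathcal A'}-Q_{\mathcal A\mathcal A'},\qquad \overline\Sigma_{\mathcal V\mathcal V}=Q_{\mathcal V\mathcal V}+\overline R_{\mathcal V\mathcal V},$$ where the blocks $\overline R_{\mathcal V_m\mathcal V_n}$ are given recursively by $R_{\mathcal V_m\mathcal V_n}$ if $|m-n|\le B$, by $R_{\mathcal V_m\mathcal D_m^B}R_{\mathcal D_m^B\mathcal D_m^B}^{-1}\overline R_{\mathcal D_m^B\mathcal V_n}$ if $n-m>B$, and by $\overline R_{\mathcal V_m\mathcal D_n^B}R_{\mathcal D_n^B\mathcal D_n^B}^{-1}R_{\mathcal D_n^B\mathcal V_n}$ if $m-n>B$. The LMA predictive mean and covariance are $$\mu^{\rm LMA}_{\mathcal U}=\mu_{\mathcal U}+\overline\Sigma_{\mathcal U\mathcal D}\overline\Sigma_{\mathcal D\mathcal D}^{-1}(y_{\mathcal D}-\mu_{\mathcal D}),\qquad \Sigma^{\rm LMA}_{\mathcal U\mathcal U}=\overline\Sigma_{\mathcal U\mathcal U}-\overline\Sigma_{\mathcal U\mathcal D}\overline\Sigma_{\mathcal D\mathcal D}^{-1}\overline\Sigma_{\mathcal D\mathcal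 U},\qquad \overline\Sigma_{\mathcal D\mathcal U}=\overline\Sigma_{\mathcal U\mathcal D}^\top .$$ With $R'_m=R_{\mathcal D_m\mathcal D_m^B}R_{\mathcal D_m^B\mathcal D_m^B}^{-1}$, the local summaries are $$\dot y_m=y_{\mathcal D_m}-\mu_{\mathcal D_m}-R'_m(y_{\mathcal D_m^B}-\mu_{\mathcal D_m^B}),\quad \dot R_m=(R_{\mathcal D_m\mathcal D_m}-R'_mR_{\mathcal D_m^B\mathcal D_m})^{-1},\quad \dot\Sigma^m_{\mathcal S}=\Sigma_{\mathcal D_m\mathcal S}-R'_m\Sigma_{\mathcal D_m^B\mathcal S},\quad \dot\Sigma^m_{\mathcal U}=\overline\Sigma_{\mathcal D_m\mathcal U}-R'_m\overline\Sigma_{\mathcal D_m^B\mathcal U},$$ and the global summary is $$\ddot y_{\mathcal S}=\sum_m(\dot\Sigma^m_{\mathcal S})^\top\dot R_m\dot y_m,\quad \ddot y_{\mathcal U}=\sum_m(\dot\Sigma^m_{\mathcal U})^\top\dot R_m\dot y_m,\quad \ddot\Sigma_{\mathcal S\mathcal S}=\Sigma_{\mathcal S\mathcal S}+\sum_m(\dot\Sigma^m_{\mathcal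 S})^\top\dot R_m\dot\Sigma^m_{\mathcal S},$$ $$\ddot\Sigma_{\mathcal U\mathcal S}=\sum_m(\dot\Sigma^m_{\mathcal U})^\top\dot R_m\dot\Sigma^m_{\mathcal S},\quad \ddot\Sigma_{\mathcal U\mathcal U}=\sum_m(\dot\Sigma^m_{\mathcal U})^\top\dot R_m\dot\Sigma^m_{\mathcal U}.$$ Suppose that the inverses $\Sigma_{\mathcal S\mathcal S}^{-1}$, $R_{\mathcal D_m^B\mathcal D_m^B}^{-1}$ and $\dot R_m$ ($m=1,\dots,M$) exist. Then $\overline\Sigma_{\mathcal D\mathcal D}$ and $\ddot\Sigma_{\mathcal S\mathcal S}$ are invertible, $$\mu^{\rm LMA}_{\mathcal U}=\mu_{\mathcal U}+\ddot y_{\mathcal U}-\ddot\Sigma_{\mathcal U\mathcal S}\ddot\Sigma_{\mathcal S\mathcal S}^{-1}\ddot y_{\mathcal S},\qquad \Sigma^{\rm LMA}_{\mathcal U\mathcal U}=\overline\Sigma_{\mathcal U\mathcal U}-\ddot\Sigma_{\mathcal U\mathcal U}+\ddot\Sigma_{\mathcal U\mathcal S}\ddot\Sigma_{\mathcal S\mathcal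 S}^{-1}\ddot\Sigma_{\mathcal U\mathcal S}^\top ,$$ and for all $m,n$ with $|m-n|\le B$ the $(\mathcal U_m,\mathcal U_n)$ block of $\Sigma^{\rm LMA}_{\mathcal U\mathcal U}$ equals that of $\Sigma_{\mathcal U\mathcal U}-\ddot\Sigma_{\mathcal U\mathcal U}+\ddot\Sigma_{\mathcal U\mathcal S}\ddot\Sigma_{\mathcal S\mathcal S}^{-1}\ddot\Sigma_{\mathcal U\mathcal S}^\top$. -/

import Mathlib

open scoped Matrix

noncomputable section

namespace LMA

variable {X : Type*} [DecidableEq X] {M : ℕ}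

/-- The matrix `k_{A A'}` with entries `k x x'` for `x ∈ A`, `x' ∈ A'`. -/
def mat (k : X → X → ℝ) (A A' : Finset X) : Matrix A A' ℝ :=
  Matrix.of fun x x' => k x x'

/-- The column vector `v_A` with components `v x` for `x ∈ A`. -/
def vec (v : X → ℝ) (A : Finset X) : A → ℝ := fun x => v x

/-- The block `A_m` of the finite set `A` of inputs. A partition of `A` into `M` disjoint blocks is
given by the map `blk` which sends an input to the index of its block. -/
def block (A : Finset X) (blk : X → Fin M) (m : Fin M) : Finset X :=
  {x ∈ A | blk x = m}

/-- `D_m^B`, the union of the blocks `D_k` with `m < k ≤ m + B` (and `k` at most the last index). -/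
def ahead (D : Finset X) (blk : X → Fin M) (B : ℕ) (m : Fin M) : Finset X :=
  {x ∈ D | m < blk x ∧ (blk x : ℕ) ≤ m + B}

/-- The reduced-rank covariance function `Q`, i.e. `Q_{x x'} = Σ_{x S} Σ_{S S}⁻¹ Σ_{S x'}`. -/
def lowRank (σ : X → X → ℝ) (S : Finset X) (x x' : X) : ℝ :=
  vec (σ x) S ⬝ᵥ ((mat σ S S)⁻¹ *ᵥ vec (fun s => σ s x') S)

/-- The residual covariance function `R = Σ - Q`. -/
def resid (σ : X → X → ℝ) (S : Finset X) (x x' : X) : ℝ :=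
  σ x x' - lowRank σ S x x'

/-- The approximate residual covariance function `R̄`: the entry of the block `R̄_{V_m V_n}` at
`x ∈ V_m`, `x' ∈ V_n`, where `m = blk x` and `n = blk x'`. In the four cases the block is

* `R_{V_m V_n}` if `|m - n| ≤ B`,
* `0` if `|m - n| > B = 0`,
* `R_{V_m D_m^B} R_{D_m^B D_m^B}⁻¹ R̄_{D_m^B V_n}` if `n - m > B > 0`,
* `R̄_{V_m D_n^B} R_{D_n^B D_n^B}⁻¹ R_{D_n^B V_n}` if `m - n > B > 0`. -/
def residBar (σ : X → X → ℝ) (S D : Finset X) (blk : X → Fin M) (B : ℕ) (x x' : X) : ℝ :=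
  if (blk x : ℕ) ≤ blk x' + B ∧ (blk x' : ℕ) ≤ blk x + B then
    resid σ S x x'
  else if B = 0 then
    0
  else if blk x < blk x' then
    (vec (resid σ S x) (ahead D blk B (blk x)) ᵥ*
        (mat (resid σ S) (ahead D blk B (blk x)) (ahead D blk B (blk x)))⁻¹) ⬝ᵥ
      (fun z : ahead D blk B (blk x) => residBar σ S D blk B z x')
  else
    (fun z : ahead D blk B (blk x') => residBar σ S D blk B x z) ⬝ᵥ
      ((mat (resid σ S) (ahead D blk B (blk x')) (ahead D blk B (blk x')))⁻¹ *ᵥ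
        vec (fun z => resid σ S z x') (ahead D blk B (blk x')))
termination_by ((blk x : ℕ) - blk x') + ((blk x' : ℕ) - blk x)
decreasing_by
  all_goals
    have hz := z.2
    simp only [ahead, Finset.mem_filter, Fin.lt_def] at hz
    simp only [Fin.lt_def] at *
    omega

/-- The approximate covariance function `Σ̄ = Q + R̄`. -/
def covBar (σ : X → X → ℝ) (S D : Finset X) (blk : X → Fin M) (B : ℕ) (x x' : X) : ℝ :=
  lowRank σ S x x' + residBar σ S D blk B x x'

/-- The predictive mean `μ_U + Σ̄_{UD} Σ̄_{DD}⁻¹ (y_D - μ_D)`. -/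
def predMean (μ : X → ℝ) (σ : X → X → ℝ) (S D U : Finset X) (blk : X → Fin M) (B : ℕ)
    (y : X → ℝ) : U → ℝ :=
  vec μ U + (mat (covBar σ S D blk B) U D * (mat (covBar σ S D blk B) D D)⁻¹) *ᵥ
    (vec y D - vec μ D)

/-- The predictive covariance `Σ̄_{UU} - Σ̄_{UD} Σ̄_{DD}⁻¹ Σ̄_{DU}`, with `Σ̄_{DU} = Σ̄_{UD}ᵀ`. -/
def predCov (σ : X → X → ℝ) (S D U : Finset X) (blk : X → Fin M) (B : ℕ) : Matrix U U ℝ :=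
  mat (covBar σ S D blk B) U U - mat (covBar σ S D blk B) U D *
    (mat (covBar σ S D blk B) D D)⁻¹ * (mat (covBar σ S D blk B) U D)ᵀ

/-! Local summaries -/

/-- `R'_{D_m D_m^B} = R_{D_m D_m^B} R_{D_m^B D_m^B}⁻¹`. -/
def gain (σ : X → X → ℝ) (S D : Finset X) (blk : X → Fin M) (B : ℕ) (m : Fin M) :
    Matrix (block D blk m) (ahead D blk B m) ℝ :=
  mat (resid σ S) (block D blk m) (ahead D blk B m) *
    (mat (resid σ S) (ahead D blk B m) (ahead D blk B m))⁻¹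

/-- `R_{D_m D_m} - R'_{D_m D_m^B} R_{D_m^B D_m}`, the matrix whose inverse is `Ṙ_m`. -/
def condResid (σ : X → X → ℝ) (S D : Finset X) (blk : X → Fin M) (B : ℕ) (m : Fin M) :
    Matrix (block D blk m) (block D blk m) ℝ :=
  mat (resid σ S) (block D blk m) (block D blk m) -
    gain σ S D blk B m * mat (resid σ S) (ahead D blk B m) (block D blk m)

/-- `ẏ_m`. -/
def locY (μ : X → ℝ) (σ : X → X → ℝ) (S D : Finset X) (blk : X → Fin M) (B : ℕ)
    (y : X → ℝ) (m : Fin M) : block D blk m → ℝ :=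
  vec y (block D blk m) - vec μ (block D blk m) -
    gain σ S D blk B m *ᵥ (vec y (ahead D blk B m) - vec μ (ahead D blk B m))

/-- `Ṙ_m`. -/
def locR (σ : X → X → ℝ) (S D : Finset X) (blk : X → Fin M) (B : ℕ) (m : Fin M) :
    Matrix (block D blk m) (block D blk m) ℝ :=
  (condResid σ S D blk B m)⁻¹

/-- `Σ̇_S^m`. -/
def locS (σ : X → X → ℝ) (S D : Finset X) (blk : X → Fin M) (B : ℕ) (m : Fin M) :
    Matrix (block D blk m) S ℝ :=
  mat σ (block D blk m) S - gain σ S D blk B m * mat σ (ahead D blk B m) S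

/-- `Σ̇_U^m`. -/
def locU (σ : X → X → ℝ) (S D U : Finset X) (blk : X → Fin M) (B : ℕ) (m : Fin M) :
    Matrix (block D blk m) U ℝ :=
  mat (covBar σ S D blk B) (block D blk m) U -
    gain σ S D blk B m * mat (covBar σ S D blk B) (ahead D blk B m) U

/-! Global summary -/

/-- `ÿ_S`. -/
def gloYS (μ : X → ℝ) (σ : X → X → ℝ) (S D : Finset X) (blk : X → Fin M) (B : ℕ)
    (y : X → ℝ) : S → ℝ :=
  ∑ m, ((locS σ S D blk B m)ᵀ * locR σ S D blk B m) *ᵥ locY μ σ S D blk B y m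

/-- `ÿ_U`. -/
def gloYU (μ : X → ℝ) (σ : X → X → ℝ) (S D U : Finset X) (blk : X → Fin M) (B : ℕ)
    (y : X → ℝ) : U → ℝ :=
  ∑ m, ((locU σ S D U blk B m)ᵀ * locR σ S D blk B m) *ᵥ locY μ σ S D blk B y m

/-- `Σ̈_{SS}`. -/
def gloSS (σ : X → X → ℝ) (S D : Finset X) (blk : X → Fin M) (B : ℕ) : Matrix S S ℝ :=
  mat σ S S + ∑ m, (locS σ S D blk B m)ᵀ * locR σ S D blk B m * locS σ S D blk B m

/-- `Σ̈_{US}`. -/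
def gloUS (σ : X → X → ℝ) (S D U : Finset X) (blk : X → Fin M) (B : ℕ) : Matrix U S ℝ :=
  ∑ m, (locU σ S D U blk B m)ᵀ * locR σ S D blk B m * locS σ S D blk B m

/-- `Σ̈_{UU}`. -/
def gloUU (σ : X → X → ℝ) (S D U : Finset X) (blk : X → Fin M) (B : ℕ) : Matrix U U ℝ :=
  ∑ m, (locU σ S D U blk B m)ᵀ * locR σ S D blk B m * locU σ S D U blk B m

end LMA

end

/-! Let `L` stack the maps v ↦ v_{D_m} - R'_m v_{D_m^B}. The recursion for R̄ makes block row m of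
`L` R̄_{DD} vanish on all later blocks, so `L` R̄_{DD} `L`ᵀ is block lower triangular; being
symmetric, it is block diagonal with blocks Ṙ_m⁻¹ (`whiten_mul_residBar_mul_transpose`). Hence
R̄_{DD}⁻¹ = `L`ᵀ diag(Ṙ_m) `L` (`residBar_inv`). The local summaries are the block rows of `L`
applied to Σ_{DS}, Σ̄_{DU} and y_D - μ_D, so each sum over m in the global summary is a product with
R̄_{DD}⁻¹ in the middle. As Σ̄_{DD} = R̄_{DD} + Σ_{DS} Σ_{SS}⁻¹ Σ_{SD}, the Woodbury identity yields
both formulas. Covariances are positive semidefinite, and Schur complements stay so; this makes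
Σ̈_{SS} positive definite. -/

namespace LMA

open Matrix

/-! ### Positive semidefinite kernels and their Schur complements. -/

section Kernel

variable {X : Type*}

/-- All finite sections of the kernel `k` are positive semidefinite matrices. -/
def IsPSDKernel (k : X → X → ℝ) : Prop :=
  ∀ A : Finset X, (mat k A A).PosSemidef

/-- The quadratic form at `v` is the variance of `∑ i, v i • Y i`. -/
theorem isPSDKernel_covariance {Ω : Type*} [MeasurableSpace Ω] {P : MeasureTheory.Measure Ω}
    [MeasureTheory.IsFiniteMeasure P] {Y : X → Ω → ℝ}
    (hY : ∀ x, MeasureTheory.MemLp (Y x) 2 P) :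
    IsPSDKernel fun x x' => ProbabilityTheory.covariance (Y x) (Y x') P := by
  intro A
  refine .of_dotProduct_mulVec_nonneg ?_ fun v => ?_
  · ext i j
    simp [mat, ProbabilityTheory.covariance_comm]
  · have hv (i : A) : MeasureTheory.MemLp (v i • Y i) 2 P := (hY i).const_smul _
    have h0 : 0 ≤ ProbabilityTheory.covariance (∑ i : A, v i • Y i) (∑ i : A, v i • Y i) P := by
      rw [ProbabilityTheory.covariance_self
        (MeasureTheory.memLp_finsetSum' _ fun i _ => hv i).aestronglyMeasurable.aemeasurable]
      exact ProbabilityTheory.variance_nonneg _ _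
    rw [ProbabilityTheory.covariance_sum_sum hv hv] at h0
    refine h0.trans_eq ?_
    simp only [dotProduct, mulVec, mat, Finset.mul_sum]
    refine Finset.sum_congr rfl fun i _ => Finset.sum_congr rfl fun j _ => ?_
    simp [ProbabilityTheory.covariance_smul_left, ProbabilityTheory.covariance_smul_right]
    ring

variable [DecidableEq X] {k : X → X → ℝ}

theorem IsPSDKernel.symm (hk : IsPSDKernel k) (x x' : X) : k x x' = k x' x := by
  have h := (hk {x, x'}).isHermitian.apply ⟨x', by simp⟩ ⟨x, by simp⟩
  simpa [mat] using h

theorem IsPSDKernel.mat_transpose (hk : IsPSDKernel k) (A A' : Finset X) :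
    (mat k A A')ᵀ = mat k A' A := by
  ext i j
  exact hk.symm _ _

/-- Repetitions in `f` are allowed because `S` and `A` may overlap in the joint matrix of
`IsPSDKernel.resid`. -/
theorem IsPSDKernel.posSemidef_of (hk : IsPSDKernel k) {ι : Type*} [Fintype ι] (f : ι → X) :
    (Matrix.of fun i j => k (f i) (f j)).PosSemidef :=
  (hk (Finset.univ.image f)).submatrix fun i => ⟨f i, by simp⟩

theorem IsPSDKernel.posDef (hk : IsPSDKernel k) {S : Finset X} (hS : IsUnit (mat k S S).det) :
    (mat k S S).PosDef :=
  (hk S).posDef_iff_isUnit.mpr ((isUnit_iff_isUnit_det _).mpr hS)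

theorem mat_lowRank (k : X → X → ℝ) (S A A' : Finset X) :
    mat (lowRank k S) A A' = mat k A S * (mat k S S)⁻¹ * mat k S A' := by
  rw [Matrix.mul_assoc]
  rfl

theorem mat_resid (k : X → X → ℝ) (S A A' : Finset X) :
    mat (resid k S) A A' = mat k A A' - mat k A S * (mat k S S)⁻¹ * mat k S A' := by
  rw [← mat_lowRank]
  rfl

theorem IsPSDKernel.resid (hk : IsPSDKernel k) {S : Finset X} (hS : IsUnit (mat k S S).det) :
    IsPSDKernel (resid k S) := by
  intro A
  have hP := hk.posDef hS
  have := hP.isUnit.invertible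
  have h := hk.posSemidef_of (Sum.elim (fun i : S => (i : X)) fun i : A => (i : X))
  have he : (Matrix.of fun i j => k (Sum.elim (fun i : S => (i : X)) (fun i : A => (i : X)) i)
      (Sum.elim (fun i : S => (i : X)) (fun i : A => (i : X)) j)) =
      fromBlocks (mat k S S) (mat k S A) (mat k S A)ᴴ (mat k A A) := by
    rw [conjTranspose_eq_transpose_of_trivial, hk.mat_transpose]
    ext (i | i) (j | j) <;> rfl
  rw [he, PosDef.fromBlocks₁₁ _ _ hP, conjTranspose_eq_transpose_of_trivial,
    hk.mat_transpose] at h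
  rwa [mat_resid]

end Kernel

section Membership

variable {X : Type*} {M : ℕ} {D : Finset X} {blk : X → Fin M} {B : ℕ}

theorem mem_ahead {m : Fin M} {x : X} :
    x ∈ ahead D blk B m ↔ x ∈ D ∧ m < blk x ∧ (blk x : ℕ) ≤ m + B := by
  simp [ahead]

theorem mem_block {m : Fin M} {x : X} : x ∈ block D blk m ↔ x ∈ D ∧ blk x = m := by
  simp [block]

end Membership

/-! ### Symmetry of R̄ and its annihilation by the gain. -/

section Residual

variable {X : Type*} [DecidableEq X] {M : ℕ} {σ : X → X → ℝ} {S D : Finset X}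
  {blk : X → Fin M} {B : ℕ}

/-- Exhibits Ṙ_m⁻¹ as a second Schur complement, so that `IsPSDKernel.resid` applies to it. -/
theorem condResid_eq_mat_resid_resid (m : Fin M) :
    condResid σ S D blk B m =
      mat (resid (resid σ S) (ahead D blk B m)) (block D blk m) (block D blk m) :=
  (mat_resid _ _ _ _).symm

theorem residBar_of_near {x x' : X} (h : (blk x : ℕ) ≤ blk x' + B)
    (h' : (blk x' : ℕ) ≤ blk x + B) : residBar σ S D blk B x x' = resid σ S x x' := by
  rw [residBar, if_pos ⟨h, h'⟩]

theorem residBar_of_far_right (hB : B ≠ 0) {x x' : X} (h : (blk x : ℕ) + B < blk x') :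
    residBar σ S D blk B x x' =
      (vec (resid σ S x) (ahead D blk B (blk x)) ᵥ*
          (mat (resid σ S) (ahead D blk B (blk x)) (ahead D blk B (blk x)))⁻¹) ⬝ᵥ
        (fun z : ahead D blk B (blk x) => residBar σ S D blk B z x') := by
  rw [residBar, if_neg (by omega), if_neg hB, if_pos (Fin.lt_def.mpr (by omega))]

theorem residBar_of_far_left (hB : B ≠ 0) {x x' : X} (h : (blk x' : ℕ) + B < blk x) :
    residBar σ S D blk B x x' =
      (fun z : ahead D blk B (blk x') => residBar σ S D blk B x z) ⬝ᵥ
        ((mat (resid σ S) (ahead D blk B (blk x')) (ahead D blk B (blk x')))⁻¹ *ᵥ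
          vec (fun z => resid σ S z x') (ahead D blk B (blk x'))) := by
  rw [residBar, if_neg (by omega), if_neg hB, if_neg (by rw [Fin.lt_def]; omega)]

/-- The two far recursions mirror each other, and replacing `x` by a point ahead of it shrinks the
block gap until the band is reached. -/
theorem residBar_symm_of_far (hB : B ≠ 0) (hr : IsPSDKernel (resid σ S)) (x x' : X)
    (h : (blk x : ℕ) + B < blk x') :
    residBar σ S D blk B x x' = residBar σ S D blk B x' x := by
  induction hn : (blk x' : ℕ) - blk x using Nat.strong_induction_on generalizing x with
  | _ n ih =>
    rw [residBar_of_far_right hB h, residBar_of_far_left hB h, ← mulVec_transpose,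
      transpose_nonsing_inv, hr.mat_transpose, dotProduct_comm]
    congr 1
    · funext z
      have hz := mem_ahead.mp z.2
      rw [Fin.lt_def] at hz
      by_cases hf : (blk z : ℕ) + B < blk x'
      · exact ih _ (by omega) _ hf rfl
      · rw [residBar_of_near (by omega) (by omega), residBar_of_near (by omega) (by omega),
          hr.symm]
    · congr 1
      funext z
      exact hr.symm _ _

theorem residBar_symm (hB : B ≠ 0) (hr : IsPSDKernel (resid σ S)) (x x' : X) :
    residBar σ S D blk B x x' = residBar σ S D blk B x' x := by
  rcases lt_or_ge ((blk x : ℕ) + B) (blk x') with h | h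
  · exact residBar_symm_of_far hB hr x x' h
  rcases lt_or_ge ((blk x' : ℕ) + B) (blk x) with h' | h'
  · exact (residBar_symm_of_far hB hr x' x h').symm
  rw [residBar_of_near h' h, residBar_of_near h h', hr.symm]

theorem lowRank_symm (hσ : IsPSDKernel σ) (x x' : X) : lowRank σ S x x' = lowRank σ S x' x := by
  rw [lowRank, lowRank, dotProduct_mulVec, ← mulVec_transpose, transpose_nonsing_inv,
    hσ.mat_transpose, dotProduct_comm]
  congr 2 <;> funext z <;> simp [vec, hσ.symm]

theorem covBar_transpose (hB : B ≠ 0) (hσ : IsPSDKernel σ) (hr : IsPSDKernel (resid σ S))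
    (A A' : Finset X) : (mat (covBar σ S D blk B) A A')ᵀ = mat (covBar σ S D blk B) A' A := by
  ext i j
  simp only [mat, transpose_apply, of_apply, covBar]
  rw [lowRank_symm hσ, residBar_symm hB hr]

theorem gain_mul_mat (hR : ∀ m, IsUnit (mat (resid σ S) (ahead D blk B m) (ahead D blk B m)).det)
    (m : Fin M) : gain σ S D blk B m * mat (resid σ S) (ahead D blk B m) (ahead D blk B m) =
      mat (resid σ S) (block D blk m) (ahead D blk B m) := by
  rw [gain, nonsing_inv_mul_cancel_right _ _ (hR m)]

/-- Conditioning a row of `R̄` on the blocks ahead annihilates everything beyond its block. -/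
theorem residBar_sub_gain_of_lt (hB : B ≠ 0)
    (hR : ∀ m, IsUnit (mat (resid σ S) (ahead D blk B m) (ahead D blk B m)).det)
    {m : Fin M} (x : block D blk m) {d : X} (hd : d ∈ D) (h : m < blk d) :
    residBar σ S D blk B x d -
      ∑ z, gain σ S D blk B m x z * residBar σ S D blk B z d = 0 := by
  obtain ⟨x, hx⟩ := x
  obtain ⟨hxD, rfl⟩ := mem_block.mp hx
  rw [Fin.lt_def] at h
  rw [sub_eq_zero]
  rcases lt_or_ge ((blk x : ℕ) + B) (blk d) with hf | hf
  · exact residBar_of_far_right hB hf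
  · have hda : d ∈ ahead D blk B (blk x) := mem_ahead.mpr ⟨hd, h, hf⟩
    rw [residBar_of_near (Nat.le_add_right_of_le (le_of_lt h)) hf]
    -- Within the band `d` itself lies in D_m^B, so the claim is one entry of R'_m R_{D_m^B D_m^B} =
    -- R_{D_m D_m^B}.
    have := congrFun (congrFun (gain_mul_mat hR (blk x)) ⟨x, hx⟩) ⟨d, hda⟩
    refine Eq.trans this.symm (Finset.sum_congr rfl fun z _ => ?_)
    have hz := mem_ahead.mp z.2
    rw [Fin.lt_def] at hz
    rw [residBar_of_near (by omega) (by omega)]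
    rfl

theorem residBar_sub_gain_of_eq {m : Fin M} (x x' : block D blk m) :
    residBar σ S D blk B x x' - ∑ z, gain σ S D blk B m x z * residBar σ S D blk B z x' =
      condResid σ S D blk B m x x' := by
  have hx := congrArg Fin.val (mem_block.mp x.2).2
  have hx' := congrArg Fin.val (mem_block.mp x'.2).2
  rw [residBar_of_near (by omega) (by omega)]
  refine congrArg _ (Finset.sum_congr rfl fun z _ => ?_)
  have hz := mem_ahead.mp z.2
  rw [Fin.lt_def] at hz
  rw [residBar_of_near (by omega) (by omega)]
  rfl

end Residual

/-! ### Block diagonalization of R̄_{DD}. -/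

section Whitening

variable {X : Type*} [DecidableEq X] {M : ℕ} {σ : X → X → ℝ} {S D : Finset X}
  {blk : X → Fin M} {B : ℕ}

theorem sum_dite_mem {A : Finset X} (hA : A ⊆ D) (f : A → ℝ) (g : X → ℝ) :
    ∑ d : D, (if h : (d : X) ∈ A then f ⟨d, h⟩ else 0) * g d = ∑ z : A, f z * g z := by
  refine (Fintype.sum_of_injective (fun z : A => (⟨z, hA z.2⟩ : D)) ?_ _ _ ?_ ?_).symm
  · exact fun a b h => Subtype.ext (congrArg (fun d : D => (d : X)) h)
  · intro d hd
    rw [dif_neg fun h => hd ⟨⟨d, h⟩, rfl⟩, zero_mul]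
  · intro z
    rw [dif_pos z.2]

variable (σ S D blk B) in
/-- The stacked matrix of the operators `v ↦ v_{D_m} - R'_m v_{D_m^B}`. -/
noncomputable def whiten : Matrix (Σ m, block D blk m) D ℝ :=
  of fun i d => (if (i.2 : X) = d then 1 else 0) -
    if h : (d : X) ∈ ahead D blk B i.1 then gain σ S D blk B i.1 i.2 ⟨d, h⟩ else 0

theorem sum_whiten_mul (g : X → ℝ) (i : Σ m, block D blk m) :
    ∑ d : D, whiten σ S D blk B i d * g d =
      g i.2 - ∑ z, gain σ S D blk B i.1 i.2 z * g z := by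
  have hi := (mem_block.mp i.2.2).1
  simp only [whiten, of_apply, sub_mul, Finset.sum_sub_distrib]
  rw [sum_dite_mem (fun x hx => (mem_ahead.mp hx).1)]
  congr 1
  rw [Finset.sum_eq_single ⟨i.2, hi⟩]
  · rw [if_pos rfl, one_mul]
  · intro d _ hd
    rw [if_neg fun h => hd (Subtype.ext h.symm), zero_mul]
  · exact fun h => absurd (Finset.mem_univ _) h

theorem whiten_mul_mat (k : X → X → ℝ) (A : Finset X) :
    whiten σ S D blk B * mat k D A = of fun i a =>
      (mat k (block D blk i.1) A - gain σ S D blk B i.1 * mat k (ahead D blk B i.1) A) i.2 a := by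
  ext i a
  exact sum_whiten_mul (fun x => k x a) i

theorem whiten_mulVec (v : X → ℝ) :
    whiten σ S D blk B *ᵥ vec v D = fun i =>
      (vec v (block D blk i.1) - gain σ S D blk B i.1 *ᵥ vec v (ahead D blk B i.1)) i.2 := by
  ext i
  exact sum_whiten_mul v i

theorem whiten_mul_residBar_mul_transpose (hB : B ≠ 0) (hr : IsPSDKernel (resid σ S))
    (hR : ∀ m, IsUnit (mat (resid σ S) (ahead D blk B m) (ahead D blk B m)).det) :
    whiten σ S D blk B * mat (residBar σ S D blk B) D D * (whiten σ S D blk B)ᵀ =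
      blockDiagonal' (condResid σ S D blk B) := by
  set L := whiten σ S D blk B
  set H := mat (residBar σ S D blk B) D D
  have hH : Hᵀ = H := by
    ext i j
    exact residBar_symm hB hr _ _
  have hsymm (i j) : (L * H * Lᵀ) i j = (L * H * Lᵀ) j i := by
    rw [← transpose_apply (L * H * Lᵀ)]
    simp only [transpose_mul, transpose_transpose, hH, Matrix.mul_assoc]
  let T (i : Σ m, block D blk m) (d : X) : ℝ := residBar σ S D blk B i.2 d -
    ∑ z, gain σ S D blk B i.1 i.2 z * residBar σ S D blk B z d
  have hT (i j) : (L * H * Lᵀ) i j = T i j.2 - ∑ z, gain σ S D blk B j.1 j.2 z * T i z := by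
    rw [← sum_whiten_mul (T i) j, mul_apply]
    refine Finset.sum_congr rfl fun d _ => ?_
    rw [mul_comm]
    exact congrArg _ (sum_whiten_mul (fun x => residBar σ S D blk B x d) i)
  have hT0 (i : Σ m, block D blk m) (d : X) (hd : d ∈ D) (h : i.1 < blk d) : T i d = 0 :=
    residBar_sub_gain_of_lt hB hR i.2 hd h
  -- Multiplying by `Lᵀ` only mixes a column block with later ones, so the zeros beyond the diagonal
  -- survive.
  have hlt (i j) (h : i.1 < j.1) : (L * H * Lᵀ) i j = 0 := by
    have hj := mem_block.mp j.2.2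
    rw [hT, hT0 i j.2 hj.1 (hj.2.symm ▸ h), zero_sub, neg_eq_zero]
    refine Finset.sum_eq_zero fun z _ => ?_
    have hz := mem_ahead.mp z.2
    rw [hT0 i z hz.1 (h.trans hz.2.1), mul_zero]
  ext ⟨m, x⟩ ⟨n, x'⟩
  rcases lt_trichotomy m n with h | rfl | h
  · rw [hlt _ _ h, blockDiagonal'_apply_ne _ _ _ h.ne]
  · rw [blockDiagonal'_apply_eq, hT, ← residBar_sub_gain_of_eq, sub_eq_self]
    refine Finset.sum_eq_zero fun z _ => mul_eq_zero_of_right _ ?_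
    have hz := mem_ahead.mp z.2
    exact hT0 _ z hz.1 hz.2.1
  · rw [hsymm, hlt _ _ h, blockDiagonal'_apply_ne _ _ _ h.ne']

/-- Turns the sums over m in the global summary into single products with the stacked matrices. -/
theorem sum_transpose_mul_mul {ι κ l : Type*} {b : ι → Type*} [Fintype ι] [DecidableEq ι]
    [∀ i, Fintype (b i)] (F : ∀ i, Matrix (b i) κ ℝ) (N : ∀ i, Matrix (b i) (b i) ℝ)
    (G : ∀ i, Matrix (b i) l ℝ) :
    ∑ i, (F i)ᵀ * N i * G i =
      (of fun (p : Σ i, b i) a => F p.1 p.2 a)ᵀ * blockDiagonal' N *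
        of fun (p : Σ i, b i) a => G p.1 p.2 a := by
  ext a c
  simp only [Matrix.sum_apply, mul_apply, Fintype.sum_sigma, transpose_apply, of_apply]
  refine Finset.sum_congr rfl fun i _ => Finset.sum_congr rfl fun y _ => ?_
  congr 1
  rw [Finset.sum_eq_single i]
  · simp
  · intro j _ hj
    exact Finset.sum_eq_zero fun x _ => by rw [blockDiagonal'_apply_ne _ _ _ hj, mul_zero]
  · simp

theorem sum_transpose_mul_mulVec {ι κ : Type*} {b : ι → Type*} [Fintype ι] [DecidableEq ι]
    [∀ i, Fintype (b i)] (F : ∀ i, Matrix (b i) κ ℝ) (N : ∀ i, Matrix (b i) (b i) ℝ)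
    (g : ∀ i, b i → ℝ) :
    ∑ i, ((F i)ᵀ * N i) *ᵥ g i =
      ((of fun (p : Σ i, b i) a => F p.1 p.2 a)ᵀ * blockDiagonal' N) *ᵥ
        fun (p : Σ i, b i) => g p.1 p.2 := by
  ext a
  have h := congrFun (congrFun
    (sum_transpose_mul_mul F N fun i => of fun y (_ : Unit) => g i y) a) ()
  rw [Matrix.sum_apply] at h
  rw [Finset.sum_apply]
  exact h

/-- The inverse of `R̄_{DD}` is the precision matrix assembled from the local summaries. -/
theorem residBar_inv (hB : B ≠ 0) (hr : IsPSDKernel (resid σ S))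
    (hR : ∀ m, IsUnit (mat (resid σ S) (ahead D blk B m) (ahead D blk B m)).det)
    (hK : ∀ m, IsUnit (condResid σ S D blk B m).det) :
    (whiten σ S D blk B)ᵀ * blockDiagonal' (locR σ S D blk B) * whiten σ S D blk B *
      mat (residBar σ S D blk B) D D = 1 := by
  -- The blocks partition `D`, so `L` is square up to reindexing and `Lᵀ` can be cycled from the
  -- right end of the product to the left.
  let e : (Σ m, block D blk m) ≃ D :=
    { toFun := fun i => ⟨i.2, (mem_block.mp i.2.2).1⟩
      invFun := fun d => ⟨blk d, ⟨d, mem_block.mpr ⟨d.2, rfl⟩⟩⟩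
      left_inv := by
        rintro ⟨m, x, hx⟩
        obtain ⟨_, rfl⟩ := mem_block.mp hx
        rfl
      right_inv := fun d => rfl }
  have h1 : blockDiagonal' (locR σ S D blk B) * blockDiagonal' (condResid σ S D blk B) = 1 := by
    rw [← blockDiagonal'_mul, ← blockDiagonal'_one]
    congr 1
    funext m
    exact nonsing_inv_mul _ (hK m)
  rw [← whiten_mul_residBar_mul_transpose hB hr hR, ← Matrix.mul_assoc,
    mul_eq_one_comm_of_equiv e] at h1
  simpa only [Matrix.mul_assoc] using h1

theorem posSemidef_blockDiagonal' {ι : Type*} {b : ι → Type*} [Fintype ι] [DecidableEq ι]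
    [∀ i, Fintype (b i)] {N : ∀ i, Matrix (b i) (b i) ℝ} (hN : ∀ i, (N i).PosSemidef) :
    (blockDiagonal' N).PosSemidef := by
  refine .of_dotProduct_mulVec_nonneg ?_ fun v => ?_
  · rw [IsHermitian, blockDiagonal'_conjTranspose]
    congr 1
    funext i
    exact (hN i).isHermitian
  · have h := congrFun (congrFun (sum_transpose_mul_mul
      (fun i => of fun y (_ : Unit) => v ⟨i, y⟩) N fun i => of fun y (_ : Unit) => v ⟨i, y⟩) ()) ()
    rw [Matrix.sum_apply, Matrix.mul_assoc] at h
    refine le_of_le_of_eq (Finset.sum_nonneg fun i _ => ?_) h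
    rw [Matrix.mul_assoc]
    exact (hN i).dotProduct_mulVec_nonneg fun y => v ⟨i, y⟩

end Whitening

/-! ### Woodbury identity and the predictive formulas. -/

section Prediction

variable {X : Type*} [DecidableEq X] {M : ℕ} {σ : X → X → ℝ} {S D : Finset X}
  {blk : X → Fin M} {B : ℕ}

/-- The Woodbury identity for `H + E C⁻¹ Eᵀ`, including invertibility. -/
theorem isUnit_det_and_inv_add_mul_inv_mul_transpose {d s : Type*} [Fintype d] [DecidableEq d]
    [Fintype s] [DecidableEq s] {H : Matrix d d ℝ} {C : Matrix s s ℝ} {E : Matrix d s ℝ}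
    (hH : IsUnit H.det) (hC : IsUnit C.det) (hW : IsUnit (C + Eᵀ * H⁻¹ * E).det) :
    IsUnit (H + E * C⁻¹ * Eᵀ).det ∧ (H + E * C⁻¹ * Eᵀ)⁻¹ =
      H⁻¹ - H⁻¹ * E * (C + Eᵀ * H⁻¹ * E)⁻¹ * Eᵀ * H⁻¹ := by
  rw [← isUnit_iff_isUnit_det] at hH hC hW ⊢
  have hCi : IsUnit C⁻¹ := isUnit_nonsing_inv_iff.mpr hC
  have hCii : C⁻¹⁻¹ = C := nonsing_inv_nonsing_inv _ ((isUnit_iff_isUnit_det _).mp hC)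
  have hW' : IsUnit (C⁻¹⁻¹ + Eᵀ * H⁻¹ * E) := by rwa [hCii]
  refine ⟨?_, by rw [add_mul_mul_inv_eq_sub _ _ _ _ hH hCi hW', hCii]⟩
  obtain ⟨_⟩ := hH.nonempty_invertible
  obtain ⟨_⟩ := hCi.nonempty_invertible
  obtain ⟨iW⟩ := hW'.nonempty_invertible
  simp only [← invOf_eq_nonsing_inv] at iW
  have := invertibleAddMulMul H E C⁻¹ Eᵀ
  exact isUnit_of_invertible _

theorem prediction_eq_summary (hσ : IsPSDKernel σ) (hB : B ≠ 0) (μ y : X → ℝ) (U : Finset X)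
    (hS : IsUnit (mat σ S S).det)
    (hR : ∀ m, IsUnit (mat (resid σ S) (ahead D blk B m) (ahead D blk B m)).det)
    (hK : ∀ m, IsUnit (condResid σ S D blk B m).det) :
    IsUnit (mat (covBar σ S D blk B) D D).det ∧ IsUnit (gloSS σ S D blk B).det ∧
    predMean μ σ S D U blk B y = vec μ U + gloYU μ σ S D U blk B y -
      (gloUS σ S D U blk B * (gloSS σ S D blk B)⁻¹) *ᵥ gloYS μ σ S D blk B y ∧
    predCov σ S D U blk B = mat (covBar σ S D blk B) U U - gloUU σ S D U blk B +
      gloUS σ S D U blk B * (gloSS σ S D blk B)⁻¹ * (gloUS σ S D U blk B)ᵀ := by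
  have hr := hσ.resid hS
  set L := whiten σ S D blk B with hL
  set N := blockDiagonal' (locR σ S D blk B) with hN
  set H := mat (residBar σ S D blk B) D D with hH
  set E := mat σ D S with hE
  set C := mat σ S S with hC
  set V := mat (covBar σ S D blk B) U D with hV
  set v := vec y D - vec μ D with hv
  have hP : Lᵀ * N * L * H = 1 := residBar_inv hB hr hR hK
  have hHi : H⁻¹ = Lᵀ * N * L := inv_eq_left_inv hP
  have hHdet : IsUnit H.det := isUnit_det_of_left_inverse hP
  have hNpsd : N.PosSemidef := posSemidef_blockDiagonal' fun m => by
    rw [locR, condResid_eq_mat_resid_resid]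
    exact (hr.resid (hR m) _).inv
  have hHpsd : (H⁻¹).PosSemidef := by
    simpa [hHi] using hNpsd.conjTranspose_mul_mul_same L
  have hHt : (H⁻¹)ᵀ = H⁻¹ := by simpa using hHpsd.isHermitian.eq
  have hlS : (of fun (p : Σ m, block D blk m) a => locS σ S D blk B p.1 p.2 a) = L * E :=
    (whiten_mul_mat _ _).symm
  have hlU : (of fun (p : Σ m, block D blk m) a => locU σ S D U blk B p.1 p.2 a) = L * Vᵀ := by
    -- `locU` is built from Σ̄_{DU}, whereas `predCov` uses Σ̄_{UD}ᵀ; symmetry of Σ̄ identifies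
    -- them.
    rw [hV, covBar_transpose hB hσ hr]
    exact (whiten_mul_mat _ _).symm
  have hlY : (fun p : Σ m, block D blk m => locY μ σ S D blk B y p.1 p.2) = L *ᵥ v :=
    (whiten_mulVec fun x => y x - μ x).symm
  have hSS : gloSS σ S D blk B = C + Eᵀ * H⁻¹ * E := by
    rw [gloSS, sum_transpose_mul_mul, hlS, hHi]
    simp only [transpose_mul, Matrix.mul_assoc, hC, hN]
  have hUS : gloUS σ S D U blk B = V * H⁻¹ * E := by
    rw [gloUS, sum_transpose_mul_mul, hlS, hlU, hHi]
    simp only [transpose_mul, transpose_transpose, Matrix.mul_assoc, hN]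
  have hUU : gloUU σ S D U blk B = V * H⁻¹ * Vᵀ := by
    rw [gloUU, sum_transpose_mul_mul, hlU, hHi]
    simp only [transpose_mul, transpose_transpose, Matrix.mul_assoc, hN]
  have hYS : gloYS μ σ S D blk B y = (Eᵀ * H⁻¹) *ᵥ v := by
    rw [gloYS, sum_transpose_mul_mulVec, hlS, hlY, hHi, mulVec_mulVec]
    simp only [transpose_mul, Matrix.mul_assoc, hN]
  have hYU : gloYU μ σ S D U blk B y = (V * H⁻¹) *ᵥ v := by
    rw [gloYU, sum_transpose_mul_mulVec, hlU, hlY, hHi, mulVec_mulVec]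
    simp only [transpose_mul, transpose_transpose, Matrix.mul_assoc, hN]
  -- A positive definite matrix plus a positive semidefinite one is invertible.
  have hW : IsUnit (C + Eᵀ * H⁻¹ * E).det := by
    have h := hHpsd.conjTranspose_mul_mul_same E
    rw [conjTranspose_eq_transpose_of_trivial] at h
    exact (isUnit_iff_isUnit_det _).mp ((hσ.posDef hS).add_posSemidef h).isUnit
  have hDD : mat (covBar σ S D blk B) D D = H + E * C⁻¹ * Eᵀ := by
    rw [hE, hσ.mat_transpose, hC, ← mat_lowRank, add_comm]
    rfl
  obtain ⟨hdet, hinv⟩ := isUnit_det_and_inv_add_mul_inv_mul_transpose hHdet hS hW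
  rw [← hDD] at hdet hinv
  refine ⟨hdet, hSS ▸ hW, ?_, ?_⟩
  · rw [predMean, hYU, hUS, hSS, hYS, hinv, mulVec_mulVec, add_sub_assoc, ← sub_mulVec]
    simp only [Matrix.mul_sub, Matrix.mul_assoc, hV, hv]
  · rw [predCov, hUU, hUS, hSS, hinv]
    simp only [← hV, transpose_mul, hHt, Matrix.mul_sub, Matrix.sub_mul, Matrix.mul_assoc]
    abel

end Prediction

end LMA

theorem theorem2 {X : Type*} [DecidableEq X] {Ω : Type*} [MeasurableSpace Ω]
    (P : MeasureTheory.Measure Ω) (Y : X → Ω → ℝ)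
    (hY : ProbabilityTheory.IsGaussianProcess Y P)
    (μ : X → ℝ) (hμ : ∀ x, μ x = ∫ ω, Y x ω ∂P)
    (σ : X → X → ℝ) (hσ : ∀ x x', σ x x' = ProbabilityTheory.covariance (Y x) (Y x') P)
    (S D U : Finset X) (hDU : Disjoint D U)
    (M : ℕ) (blk : X → Fin M) (B : ℕ) (hB : 0 < B) (hBM : B < M)
    (y : X → ℝ)
    (hS : IsUnit (LMA.mat σ S S).det)
    (hR : ∀ m, IsUnit (LMA.mat (LMA.resid σ S)
      (LMA.ahead D blk B m) (LMA.ahead D blk B m)).det)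
    (hRdot : ∀ m, IsUnit (LMA.condResid σ S D blk B m).det) :
    IsUnit (LMA.mat (LMA.covBar σ S D blk B) D D).det ∧
    IsUnit (LMA.gloSS σ S D blk B).det ∧
    LMA.predMean μ σ S D U blk B y =
      LMA.vec μ U + LMA.gloYU μ σ S D U blk B y -
        (LMA.gloUS σ S D U blk B * (LMA.gloSS σ S D blk B)⁻¹) *ᵥ LMA.gloYS μ σ S D blk B y ∧
    LMA.predCov σ S D U blk B =
      LMA.mat (LMA.covBar σ S D blk B) U U - LMA.gloUU σ S D U blk B +
        LMA.gloUS σ S D U blk B * (LMA.gloSS σ S D blk B)⁻¹ * (LMA.gloUS σ S D U blk B)ᵀ ∧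
    (∀ u u' : U, (blk u : ℕ) ≤ blk u' + B → (blk u' : ℕ) ≤ blk u + B →
      LMA.predCov σ S D U blk B u u' =
        (LMA.mat σ U U - LMA.gloUU σ S D U blk B +
          LMA.gloUS σ S D U blk B * (LMA.gloSS σ S D blk B)⁻¹ *
            (LMA.gloUS σ S D U blk B)ᵀ) u u') := by
  have := hY.isProbabilityMeasure
  have hpsd : LMA.IsPSDKernel σ := by
    rw [show σ = _ from funext fun x => funext (hσ x)]
    exact LMA.isPSDKernel_covariance fun x => (hY.hasGaussianLaw_eval x).memLp_two
  obtain ⟨hD, hSS, hmean, hcov⟩ := LMA.prediction_eq_summary hpsd hB.ne' μ y U hS hR hRdot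
  refine ⟨hD, hSS, hmean, hcov, fun u u' h h' => ?_⟩
  -- Inside the band R̄ = R, so Σ̄ = Q + (Σ - Q) = Σ.
  have hband : LMA.mat (LMA.covBar σ S D blk B) U U u u' = LMA.mat σ U U u u' := by
    simp only [LMA.mat, Matrix.of_apply, LMA.covBar, LMA.residBar_of_near h h', LMA.resid]
    ring
  rw [hcov]
  simp only [Matrix.add_apply, Matrix.sub_apply, hband]
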